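/- Let $H$ be a real separable Hilbert space with an orthonormal basis $(e_n)_{n\in\mathbb N}$, and let $A$ be the infinitesimal generator of a $C_0$-semigroup $(S(t))_{t\ge 0}$ on $H$ such that $e_n\in D(A^*)$ for every $n$, where $A^*$ is the adjoint of $A$. Let $(L^n)_{n\in\mathbb N}$ be independent, identically distributed, càdlàg, real-valued Lévy processes on a probability space $(\Omega,\mathcal F,\mathbb P)$, whose jump intensity (Lévy measure) $\nu$ is not identically $0$, and let $(\beta_n)$ be a sequence of positive numbers which does not converge to $0$. Put formally $L(t)=\sum_n\beta_nL^n(t)e_n$, and let $$X(t)=\int_0^tS(t-s)\,dL(s)=\sum_n\beta_n\int_0^tS(t-s)e_n\,dL^n(s),\qquad t\ge 0,$$ be the generalized Ornstein–Uhlenbeck process, i.e. the solution of $dX=AX\,dt+dL$, $X(0)=0$. Here $\int_0^tS(t-s)e_n\,dL^n(s)$ is the limit in probability, in $H$, of the left-endpoint Riemann sums over the uniform partitions of $[0,t]$, and, since $L$ need not take values in $H$, the series is understood coordinatewise: for every $m$, $$\langle X(t),e_m\rangle=\sum_n\beta_n\Big\langle\int_0^tS(t-s)e_n\,dL^n(s),\,e_m\Big\rangle\quad\text{in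 probability.}$$ Assume that $X$ is an $H$-valued process. Then $X$ has no $H$-càdlàg modification: there is no $H$-valued process $Y$ such that $\mathbb P(Y(t)=X(t))=1$ for every $t\ge 0$ and such that almost every trajectory $t\mapsto Y(t)\in H$ is right-continuous on $[0,\infty)$ with left limits in $H$ (for the norm of $H$). -/

import Mathlib

open MeasureTheory ProbabilityTheory Filter Topology
open scoped NNReal ENNReal

noncomputable section

namespace OUProcess

/-- A path `f : [0, ∞) → E` is càdlàg: it is right-continuous and has a left limit (an element of
`E`) at every point. At `t = 0` the second condition is void. -/
def IsCadlag {E : Type*} [TopologicalSpace E] (f : ℝ≥0 → E) : Prop :=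
  ∀ t : ℝ≥0, ContinuousWithinAt f (Set.Ici t) t ∧ ∃ l : E, Tendsto f (𝓝[<] t) (𝓝 l)

/-- `Y` is a modification of `X`: for each `t`, `Y t = X t` almost surely. -/
def IsModification {Ω E : Type*} {mΩ : MeasurableSpace Ω} (P : Measure Ω)
    (X Y : ℝ≥0 → Ω → E) : Prop :=
  ∀ t : ℝ≥0, Y t =ᵐ[P] X t

/-- `Y` is a càdlàg modification of `X` (almost all paths of `Y` are càdlàg). -/
def IsCadlagModification {Ω E : Type*} {mΩ : MeasurableSpace Ω} [TopologicalSpace E]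
    (P : Measure Ω) (X Y : ℝ≥0 → Ω → E) : Prop :=
  IsModification P X Y ∧ ∀ᵐ ω ∂P, IsCadlag (fun t => Y t ω)

/-- A càdlàg real-valued Lévy process. Stochastic continuity follows from right-continuity of the
paths and stationarity of the increments. -/
structure IsCadlagLevyProcess {Ω : Type*} {mΩ : MeasurableSpace Ω} (Z : ℝ≥0 → Ω → ℝ)
    (P : Measure Ω) : Prop where
  measurable : ∀ t, Measurable (Z t)
  zero : Z 0 =ᵐ[P] 0
  indepIncrements : HasIndepIncrements Z P
  stationaryIncrements : ∀ s h : ℝ≥0,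
    IdentDistrib (fun ω => Z (s + h) ω - Z s ω) (fun ω => Z h ω - Z 0 ω) P P
  cadlag : ∀ᵐ ω ∂P, IsCadlag (fun t => Z t ω)

/-- The jump `Δf(t) = f(t) - f(t-)` of a càdlàg path (with `f(0-) = f(0)`). -/
def jump (f : ℝ≥0 → ℝ) (t : ℝ≥0) : ℝ := f t - Function.leftLim f t

/-- `ν` is the jump intensity (Lévy measure) of `Z`: for each Borel set `B`, `ν B` is the expected
number of (nonzero) jumps of `Z` in the time interval `(0, 1]` whose size belongs to `B`. -/
def IsJumpIntensity {Ω : Type*} {mΩ : MeasurableSpace Ω} (Z : ℝ≥0 → Ω → ℝ) (P : Measure Ω)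
    (ν : Measure ℝ) : Prop :=
  ∀ B : Set ℝ, MeasurableSet B →
    ν B = ∫⁻ ω, (({s : ℝ≥0 | s ∈ Set.Ioc 0 1 ∧ jump (fun t => Z t ω) s ≠ 0 ∧
      jump (fun t => Z t ω) s ∈ B}.encard : ℕ∞) : ℝ≥0∞) ∂P

/-- A `C₀`-semigroup of bounded linear operators on `H`. -/
structure C0Semigroup (H : Type*) [NormedAddCommGroup H] [NormedSpace ℝ H] where
  /-- The operators of the semigroup. -/
  op : ℝ≥0 → H →L[ℝ] H
  op_zero : op 0 = ContinuousLinearMap.id ℝ H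
  op_add : ∀ s t : ℝ≥0, op (s + t) = (op s).comp (op t)
  strongly_continuous : ∀ x : H, Continuous (fun t => op t x)

namespace C0Semigroup

variable {H : Type*} [NormedAddCommGroup H] [NormedSpace ℝ H]

/-- The difference quotient `(S(r)x - x) / r`. -/
def quot (S : C0Semigroup H) (x : H) (r : ℝ≥0) : H := (r : ℝ)⁻¹ • (S.op r x - x)

theorem tendsto_quot_add (S : C0Semigroup H) {x y a b : H}
    (hx : Tendsto (S.quot x) (𝓝[>] 0) (𝓝 a)) (hy : Tendsto (S.quot y) (𝓝[>] 0) (𝓝 b)) :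
    Tendsto (S.quot (x + y)) (𝓝[>] 0) (𝓝 (a + b)) := by
  refine (hx.add hy).congr fun r => ?_
  simp only [quot, map_add, ← smul_add]
  congr 1
  abel

theorem tendsto_quot_smul (S : C0Semigroup H) (c : ℝ) {x a : H}
    (hx : Tendsto (S.quot x) (𝓝[>] 0) (𝓝 a)) :
    Tendsto (S.quot (c • x)) (𝓝[>] 0) (𝓝 (c • a)) := by
  refine (hx.const_smul c).congr fun r => ?_
  simp only [quot, map_smul, ← smul_sub]
  rw [smul_comm]

/-- The infinitesimal generator `A` of `S`: its domain consists of all `x` for which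
`(S(r)x - x) / r` converges as `r ↓ 0`, and `A x` is the limit. -/
def generator (S : C0Semigroup H) : H →ₗ.[ℝ] H where
  domain :=
    { carrier := {x | ∃ y, Tendsto (S.quot x) (𝓝[>] 0) (𝓝 y)}
      add_mem' := fun ⟨_, ha⟩ ⟨_, hb⟩ => ⟨_, S.tendsto_quot_add ha hb⟩
      zero_mem' := ⟨0, by
        have h : S.quot 0 = fun _ => (0 : H) := by
          funext r
          simp [quot]
        rw [h]
        exact tendsto_const_nhds⟩
      smul_mem' := fun c _ ⟨_, ha⟩ => ⟨_, S.tendsto_quot_smul c ha⟩ }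
  toFun :=
    { toFun := fun x => limUnder (𝓝[>] 0) (S.quot (x : H))
      map_add' := fun x y =>
        (S.tendsto_quot_add (tendsto_nhds_limUnder x.2) (tendsto_nhds_limUnder y.2)).limUnder_eq
      map_smul' := fun c x =>
        (S.tendsto_quot_smul c (tendsto_nhds_limUnder x.2)).limUnder_eq }

end C0Semigroup

/-- `I` is the stochastic integral `∫₀ᵗ f(s) dZ(s)` of a continuous deterministic function `f` with
respect to the real Lévy process `Z`: the limit in probability of the left-endpoint Riemann sums
`∑_{k<N} (Z(t(k+1)/N) - Z(tk/N)) f(tk/N)` as `N → ∞`. -/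
def IsStochasticIntegral {Ω E : Type*} {mΩ : MeasurableSpace Ω} [NormedAddCommGroup E]
    [NormedSpace ℝ E] (P : Measure Ω) (Z : ℝ≥0 → Ω → ℝ) (t : ℝ≥0) (f : ℝ≥0 → E) (I : Ω → E) :
    Prop :=
  TendstoInMeasure P
    (fun (N : ℕ) ω => ∑ k ∈ Finset.range N,
      (Z (t * ((k : ℝ≥0) + 1) / N) ω - Z (t * (k : ℝ≥0) / N) ω) • f (t * (k : ℝ≥0) / N))
    atTop I

/-- The `H`-valued process `X` is the stochastic convolution `X(t) = ∫₀ᵗ S(t-s) dL(s)` with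
`L(t) = ∑ₙ βₙ Lⁿ(t) eₙ`, i.e. `X(t) = ∑ₙ βₙ ∫₀ᵗ S(t-s) eₙ dLⁿ(s)` for every `t ≥ 0`.

As `L` itself need not take values in `H`, the series over `n` is only required to converge
coordinatewise with respect to the basis `(eₘ)`, in probability. This determines `X(t)` almost
surely, and it is implied by convergence in probability in `H`, by weak convergence in `H`, and by
convergence in any larger space to which all the coordinate functionals `⟨eₘ, ·⟩` extend
continuously. -/
def IsStochasticConvolution {Ω H : Type*} {mΩ : MeasurableSpace Ω} [NormedAddCommGroup H]
    [InnerProductSpace ℝ H] (P : Measure Ω) (S : C0Semigroup H) (e : HilbertBasis ℕ ℝ H)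
    (β : ℕ → ℝ) (L : ℕ → ℝ≥0 → Ω → ℝ) (X : ℝ≥0 → Ω → H) : Prop :=
  ∀ t : ℝ≥0, ∃ J : ℕ → Ω → H,
    (∀ n, IsStochasticIntegral P (L n) t (fun s => S.op (t - s) (e n)) (J n)) ∧
    ∀ m, TendstoInMeasure P
      (fun (N : ℕ) ω => ∑ n ∈ Finset.range N, β n * inner ℝ (e m) (J n ω))
      atTop (fun ω => inner ℝ (e m) (X t ω))

end OUProcess

end

namespace OUProcess

/-! ### Càdlàg paths -/

/-! A càdlàg path in `H` has totally bounded range on `[0, 2]`, so its coordinates along an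
orthonormal sequence tend to `0` uniformly on `[0, 2]`. A càdlàg modification would therefore force
`sup |⟨e m, X t⟩|` over a countable set `T` of times below `2` to tend to `0` in probability
(`IsCadlagModification.tendsto_measure_exists_lt`).

Against this stand the jumps of the driving processes. Since `e m ∈ D(A*)`, the function `r ↦ ⟨e m,
S(r) e m⟩` is `C¹` with value `1` at `0`, and integration by parts turns the contribution of `L m`
to the `m`-th coordinate into `U = β m * (L m + a continuous path)`. The other drivers contribute an
independent `R`, about which nothing else is known. Symmetrization removes it: for an independent
copy `U'` of `U`, if `U - U'` exceeds `2c` somewhere on `T`, then `U + R` or `U' + R` exceeds `c`.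
Now `L m` oscillates by more than `δ` near some time `s`, with a positive probability independent of
`m`, while the independent copy is almost surely continuous at `s`. Hence `U - U'` is at least of
order `β m * δ` with that probability. As `β m ≥ ε` for infinitely many `m`, this is a contradiction
(`IsStochasticConvolution.measure_oscillating_le`).

Jumps enter only as oscillations along countably many times: such events are measurable on path
space and depend only on the law. -/

theorem IsCadlag.totallyBounded_image {E : Type*} [PseudoMetricSpace E] {f : ℝ≥0 → E}
    (hf : IsCadlag f) {K : Set ℝ≥0} (hK : IsCompact K) : TotallyBounded (f '' K) := by
  rw [Metric.totallyBounded_iff]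
  intro ε hε
  refine hK.induction_on
    (p := fun s => ∃ t : Set E, t.Finite ∧ f '' s ⊆ ⋃ y ∈ t, Metric.ball y ε) ?_ ?_ ?_ ?_
  · exact ⟨∅, Set.finite_empty, by simp⟩
  · rintro s t hst ⟨u, hu, h⟩
    exact ⟨u, hu, (Set.image_mono hst).trans h⟩
  · rintro s t ⟨u, hu, h⟩ ⟨v, hv, h'⟩
    refine ⟨u ∪ v, hu.union hv, ?_⟩
    rw [Set.image_union, Set.biUnion_union]
    exact Set.union_subset_union h h'
  -- Near `x`, two balls suffice: one around the left limit for earlier times, one around `f x` for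
  -- later times.
  · intro x _
    obtain ⟨hr, l, hl⟩ := hf x
    have h1 : f ⁻¹' Metric.ball (f x) ε ∈ 𝓝[≥] x := hr (Metric.ball_mem_nhds _ hε)
    have h2 : f ⁻¹' Metric.ball l ε ∈ 𝓝[<] x := hl (Metric.ball_mem_nhds _ hε)
    refine ⟨f ⁻¹' Metric.ball l ε ∪ f ⁻¹' Metric.ball (f x) ε, ?_, {l, f x}, by simp, ?_⟩
    · refine mem_nhdsWithin_of_mem_nhds ?_
      rw [← nhdsLT_sup_nhdsGE x]
      exact union_mem_sup h2 h1
    · rw [Set.biUnion_pair, ← Set.preimage_union]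
      exact Set.image_preimage_subset _ _

theorem IsCadlag.exists_bound {f : ℝ≥0 → ℝ} (hf : IsCadlag f) (T : ℝ≥0) :
    ∃ C, ∀ t ≤ T, |f t| ≤ C := by
  obtain ⟨C, hC⟩ := (hf.totallyBounded_image (isCompact_Icc (a := 0) (b := T))).isBounded.exists_norm_le
  exact ⟨C, fun t ht => hC _ ⟨t, ⟨zero_le, ht⟩, rfl⟩⟩

/-- The first point of the grid `{t k / N}` beyond `s`. -/
noncomputable def nextGridPoint (t : ℝ≥0) (N : ℕ) (s : ℝ≥0) : ℝ≥0 := t * ((⌊s * N / t⌋₊ : ℝ≥0) + 1) / N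

theorem le_nextGridPoint {t : ℝ≥0} (ht : 0 < t) {N : ℕ} (hN : 0 < N) (s : ℝ≥0) :
    s ≤ nextGridPoint t N s := by
  have hN' : (0 : ℝ≥0) < N := by exact_mod_cast hN
  rw [nextGridPoint, le_div_iff₀ hN', ← div_le_iff₀' ht]
  exact (Nat.lt_floor_add_one _).le

theorem nextGridPoint_le {t : ℝ≥0} (ht : 0 < t) {N : ℕ} (hN : 0 < N) (s : ℝ≥0) :
    nextGridPoint t N s ≤ s + t / N := by
  have hN' : (0 : ℝ≥0) < N := by exact_mod_cast hN
  have h : (⌊s * N / t⌋₊ : ℝ≥0) ≤ s * N / t := Nat.floor_le zero_le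
  calc nextGridPoint t N s ≤ t * (s * N / t + 1) / N := by unfold nextGridPoint; gcongr
    _ = s + t / N := by field_simp

theorem tendsto_nextGridPoint {t : ℝ≥0} (ht : 0 < t) (s : ℝ≥0) :
    Tendsto (fun N => nextGridPoint t N s) atTop (𝓝[≥] s) := by
  refine tendsto_nhdsWithin_iff.2 ⟨?_, ?_⟩
  · refine tendsto_of_tendsto_of_tendsto_of_le_of_le' (tendsto_const_nhds (x := s))
      (h := fun N : ℕ => s + t / N) ?_ ?_ ?_
    · simpa using (tendsto_const_nhds (x := s)).add
        (tendsto_const_div_atTop_nhds_zero_nat t)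
    · filter_upwards [eventually_gt_atTop 0] with N hN using le_nextGridPoint ht hN s
    · filter_upwards [eventually_gt_atTop 0] with N hN using nextGridPoint_le ht hN s
  · filter_upwards [eventually_gt_atTop 0] with N hN using le_nextGridPoint ht hN s

theorem measurable_comp_nextGridPoint (f : ℝ≥0 → ℝ) (t : ℝ≥0) (N : ℕ) :
    Measurable fun s => f (nextGridPoint t N s) := by
  have h : Measurable fun s : ℝ≥0 => ⌊s * N / t⌋₊ :=
    Nat.measurable_floor.comp (by fun_prop)
  exact (measurable_from_nat (f := fun k : ℕ => f (t * ((k : ℝ≥0) + 1) / N))).comp h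

/-- Grid points approach `s` from the right, so right-continuity makes `f` a pointwise limit of step
functions. -/
theorem IsCadlag.measurable {f : ℝ≥0 → ℝ} (hf : IsCadlag f) : Measurable f := by
  refine measurable_of_tendsto_metrizable (fun N => measurable_comp_nextGridPoint f 1 N) ?_
  rw [tendsto_pi_nhds]
  intro s
  exact (hf s).1.tendsto.comp (tendsto_nextGridPoint one_pos s)

/-- The convolution `∫₀ᵗ G(t - s) f(s) ds` of a continuous kernel with a path. -/
noncomputable def pathConv (G : ℝ → ℝ) (f : ℝ≥0 → ℝ) (t : ℝ≥0) : ℝ :=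
  ∫ s in (0 : ℝ)..t, G (t - s) * f s.toNNReal

theorem continuous_pathConv {G : ℝ → ℝ} (hG : Continuous G) {f : ℝ≥0 → ℝ} (hf : IsCadlag f) :
    Continuous (pathConv G f) := by
  rw [continuous_iff_continuousAt]
  intro t₀
  set T : ℝ≥0 := t₀ + 1 with hT
  obtain ⟨C, hC⟩ := hf.exists_bound T
  obtain ⟨B, hB⟩ := (isCompact_Icc (a := (0 : ℝ)) (b := T)).exists_bound_of_continuousOn
    hG.continuousOn
  -- The indicator moves the variable endpoint into the integrand; for `s ≠ t₀` the integrand is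
  -- continuous in `t` at `t₀`, and dominated convergence applies.
  let F : ℝ≥0 → ℝ → ℝ := fun t s => (Set.Iic (t : ℝ)).indicator (fun s => G (t - s) * f s.toNNReal) s
  have hlt : ∀ᶠ t : ℝ≥0 in 𝓝 t₀, t < T := eventually_lt_nhds (by simp [hT])
  have hF : ∀ᶠ t : ℝ≥0 in 𝓝 t₀, pathConv G f t = ∫ s in (0 : ℝ)..T, F t s := by
    filter_upwards [hlt] with t ht
    rw [pathConv]
    exact (intervalIntegral.integral_indicator (a₁ := 0) (a₂ := (t : ℝ)) (a₃ := (T : ℝ))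
      ⟨t.coe_nonneg, by exact_mod_cast ht.le⟩).symm
  refine ContinuousAt.congr ?_ (hF.mono fun t ht => ht.symm)
  have hmeas : ∀ t : ℝ≥0, Measurable (F t) := fun t =>
    Measurable.indicator (by
      have := hf.measurable.comp measurable_real_toNNReal
      exact ((hG.comp (by fun_prop)).measurable).mul this) measurableSet_Iic
  refine intervalIntegral.continuousAt_of_dominated_interval (bound := fun _ => B * C)
    (Eventually.of_forall fun t => (hmeas t).aestronglyMeasurable) ?_ (by simp) ?_
  · filter_upwards [hlt] with t ht
    refine Eventually.of_forall fun s hs => ?_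
    rw [Set.uIoc_of_le T.coe_nonneg] at hs
    have hB0 : 0 ≤ B := (norm_nonneg _).trans (hB 0 ⟨le_rfl, T.coe_nonneg⟩)
    have hC0 : 0 ≤ C := (abs_nonneg _).trans (hC 0 zero_le)
    by_cases hst : s ≤ t
    · simp only [F, Set.indicator_of_mem (show s ∈ Set.Iic (t : ℝ) from hst), norm_mul]
      have htT : (t : ℝ) ≤ T := by exact_mod_cast ht.le
      gcongr
      · exact hB _ ⟨by linarith, by linarith [hs.1]⟩
      · exact hC _ (by rw [Real.toNNReal_le_iff_le_coe]; exact hs.2)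
    · simp only [F, Set.indicator_of_notMem (show s ∉ Set.Iic (t : ℝ) from hst), norm_zero]
      positivity
  · filter_upwards [(Set.countable_singleton (t₀ : ℝ)).ae_notMem volume] with s hs _
    rcases lt_or_gt_of_ne (show s ≠ t₀ from hs) with h | h
    · have : ∀ᶠ t : ℝ≥0 in 𝓝 t₀, F t s = G (t - s) * f s.toNNReal := by
        have : ∀ᶠ t : ℝ≥0 in 𝓝 t₀, s < t := NNReal.continuous_coe.continuousAt.eventually_const_lt h
        filter_upwards [this] with t ht
        exact Set.indicator_of_mem (show s ∈ Set.Iic (t : ℝ) from ht.le) _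
      refine ContinuousAt.congr ?_ (this.mono fun t ht => ht.symm)
      exact Continuous.continuousAt (by fun_prop)
    · have : ∀ᶠ t : ℝ≥0 in 𝓝 t₀, F t s = 0 := by
        have : ∀ᶠ t : ℝ≥0 in 𝓝 t₀, t < s := NNReal.continuous_coe.continuousAt.eventually_lt_const h
        filter_upwards [this] with t ht
        exact Set.indicator_of_notMem (show s ∉ Set.Iic (t : ℝ) from not_le.2 ht) _
      exact continuousAt_const.congr (this.mono fun t ht => ht.symm)

/-- Exactly the increments starting at grid points `≤ s` survive, and they telescope. The condition
`s < t` keeps the last index below `N`. -/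
theorem sum_indicator_increments {t : ℝ≥0} (ht : 0 < t) {N : ℕ} (hN : 0 < N) (f : ℝ≥0 → ℝ) {s : ℝ}
    (hs : 0 ≤ s) (hst : s < t) :
    ∑ k ∈ Finset.range N, (Set.Ici ((t * (k : ℝ≥0) / N : ℝ≥0) : ℝ)).indicator
      (fun _ => f (t * ((k : ℝ≥0) + 1) / N) - f (t * (k : ℝ≥0) / N)) s =
      f (nextGridPoint t N s.toNNReal) - f 0 := by
  have hN' : (0 : ℝ≥0) < N := by exact_mod_cast hN
  lift s to ℝ≥0 using hs
  rw [Real.toNNReal_coe]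
  set j := ⌊s * N / t⌋₊ with hj
  have hst' : s < t := by exact_mod_cast hst
  have hjN : j < N := by
    rw [hj, Nat.floor_lt zero_le, div_lt_iff₀ ht, mul_comm]
    gcongr
  have hmem : ∀ k : ℕ, (s : ℝ) ∈ Set.Ici ((t * (k : ℝ≥0) / N : ℝ≥0) : ℝ) ↔ k < j + 1 := by
    intro k
    rw [Set.mem_Ici, NNReal.coe_le_coe, Nat.lt_succ_iff, hj, Nat.le_floor_iff zero_le,
      le_div_iff₀ ht, div_le_iff₀ hN', mul_comm]
  simp only [Set.indicator_apply, hmem]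
  rw [← Finset.sum_filter]
  have : (Finset.range N).filter (fun k => k < j + 1) = Finset.range (j + 1) := by
    ext k; simp; omega
  rw [this]
  have := Finset.sum_range_sub (fun k : ℕ => f (t * (k : ℝ≥0) / N)) (j + 1)
  push_cast at this
  simpa [nextGridPoint, ← hj] using this

/-- Pathwise integration by parts: the Riemann sums of `∫₀ᵗ g(t - s) df(s)` converge when `f` is
càdlàg and `g` is continuously differentiable. -/
theorem tendsto_riemannSum {G : ℝ → ℝ} (hG : Continuous G) {g : ℝ≥0 → ℝ} {c : ℝ}
    (hg : ∀ r : ℝ≥0, g r = c + ∫ u in (0 : ℝ)..r, G u) {f : ℝ≥0 → ℝ} (hf : IsCadlag f)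
    (hf0 : f 0 = 0) (t : ℝ≥0) :
    Tendsto (fun N : ℕ => ∑ k ∈ Finset.range N,
        (f (t * ((k : ℝ≥0) + 1) / N) - f (t * (k : ℝ≥0) / N)) * g (t - t * (k : ℝ≥0) / N))
      atTop (𝓝 (c * f t + pathConv G f t)) := by
  rcases eq_or_ne t 0 with rfl | ht0
  · simp [pathConv, hf0]
  have ht : 0 < t := pos_iff_ne_zero.2 ht0
  -- The next grid point may overshoot `t`, but by at most `t / N ≤ t`.
  obtain ⟨C, hC⟩ := hf.exists_bound (t + t)
  obtain ⟨B, hB⟩ := (isCompact_Icc (a := (0 : ℝ)) (b := t)).exists_bound_of_continuousOn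
    hG.continuousOn
  -- Summation by parts: each weight `g (t - tₖ)` is `c` plus the integral of `G (t - s)` over `[tₖ,
  -- t]`; after exchanging sum and integral, the increments telescope.
  have key : ∀ᶠ N : ℕ in atTop, ∑ k ∈ Finset.range N,
      (f (t * ((k : ℝ≥0) + 1) / N) - f (t * (k : ℝ≥0) / N)) * g (t - t * (k : ℝ≥0) / N) =
      c * f t + ∫ s in (0 : ℝ)..t, G (t - s) * f (nextGridPoint t N s.toNNReal) := by
    filter_upwards [eventually_gt_atTop 0] with N hN
    have hN' : (0 : ℝ≥0) < N := by exact_mod_cast hN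
    have hle : ∀ k ∈ Finset.range N, t * (k : ℝ≥0) / N ≤ t := fun k hk => by
      rw [div_le_iff₀ hN']
      gcongr
      exact (Finset.mem_range.1 hk).le
    have hterm : ∀ k ∈ Finset.range N, g (t - t * (k : ℝ≥0) / N) = c + ∫ s in (0 : ℝ)..t,
        (Set.Ici ((t * (k : ℝ≥0) / N : ℝ≥0) : ℝ)).indicator (fun s => G (t - s)) s := by
      intro k hk
      set a : ℝ≥0 := t * (k : ℝ≥0) / N
      have hat : (a : ℝ) ≤ t := by exact_mod_cast hle k hk
      rw [hg, NNReal.coe_sub (hle k hk)]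
      congr 1
      have h1 : ∫ u in (0 : ℝ)..(t - a), G u = ∫ s in (a : ℝ)..t, G (t - s) := by
        rw [intervalIntegral.integral_comp_sub_left]; simp
      rw [h1, intervalIntegral.integral_of_le hat, intervalIntegral.integral_of_le t.coe_nonneg,
        ← integral_Icc_eq_integral_Ioc, ← integral_Icc_eq_integral_Ioc,
        setIntegral_indicator measurableSet_Ici]
      congr 2
      ext x
      simp only [Set.mem_Icc, Set.mem_inter_iff, Set.mem_Ici]
      constructor
      · rintro ⟨h, h'⟩; exact ⟨⟨a.coe_nonneg.trans h, h'⟩, h⟩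
      · rintro ⟨⟨_, h'⟩, h⟩; exact ⟨h, h'⟩
    have hint : ∀ k ∈ Finset.range N, IntervalIntegrable (fun s =>
        (f (t * ((k : ℝ≥0) + 1) / N) - f (t * (k : ℝ≥0) / N)) *
        (Set.Ici ((t * (k : ℝ≥0) / N : ℝ≥0) : ℝ)).indicator (fun s => G (t - s)) s)
        volume (0 : ℝ) t := by
      intro k _
      have : Continuous fun s : ℝ => G (t - s) := hG.comp (by fun_prop)
      have h := this.intervalIntegrable (μ := volume) 0 t
      rw [intervalIntegrable_iff] at h ⊢
      exact (h.indicator measurableSet_Ici).const_mul _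
    rw [Finset.sum_congr rfl fun k hk => by rw [hterm k hk, mul_add]]
    rw [Finset.sum_add_distrib, ← Finset.sum_mul]
    congr 1
    · have := Finset.sum_range_sub (fun k : ℕ => f (t * (k : ℝ≥0) / N)) N
      push_cast at this
      rw [this]
      simp [hf0, mul_div_assoc, div_self hN'.ne', mul_comm]
    · simp_rw [← intervalIntegral.integral_const_mul]
      rw [← intervalIntegral.integral_finsetSum hint]
      refine intervalIntegral.integral_congr_ae ?_
      filter_upwards [(Set.countable_singleton (t : ℝ)).ae_notMem volume] with s hs hs'
      rw [Set.uIoc_of_le t.coe_nonneg] at hs'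
      have hst : s < t := lt_of_le_of_ne hs'.2 hs
      have := sum_indicator_increments ht hN f hs'.1.le hst
      rw [hf0, sub_zero] at this
      rw [← this, Finset.mul_sum]
      refine Finset.sum_congr rfl fun k _ => ?_
      simp only [Set.indicator_apply]
      split_ifs <;> ring
  refine Tendsto.congr' (key.mono fun N h => h.symm) (Tendsto.const_add _ ?_)
  refine intervalIntegral.tendsto_integral_filter_of_dominated_convergence (fun _ => B * C)
    (Eventually.of_forall fun N => ?_) ?_ (by simp) ?_
  · have h1 : Measurable fun s : ℝ => f (nextGridPoint t N s.toNNReal) :=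
      (measurable_comp_nextGridPoint f t N).comp measurable_real_toNNReal
    have h2 : Measurable fun s : ℝ => G (t - s) := (hG.comp (by fun_prop)).measurable
    exact (h2.mul h1).aestronglyMeasurable
  · filter_upwards [eventually_gt_atTop 0] with N hN
    refine Eventually.of_forall fun s hs => ?_
    rw [Set.uIoc_of_le t.coe_nonneg] at hs
    rw [norm_mul]
    have hB0 : 0 ≤ B := (norm_nonneg _).trans (hB 0 ⟨le_rfl, t.coe_nonneg⟩)
    gcongr
    · exact hB _ ⟨by linarith [hs.2], by linarith [hs.1]⟩
    · refine hC _ ((nextGridPoint_le ht hN _).trans ?_)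
      gcongr
      · rw [Real.toNNReal_le_iff_le_coe]; exact hs.2
      · exact div_le_self zero_le (by exact_mod_cast hN)
  · refine Eventually.of_forall fun s _ => Tendsto.const_mul _ ?_
    exact (hf _).1.tendsto.comp (tendsto_nextGridPoint ht _)

/-! ### Weak differentiability of the orbits of a semigroup -/

namespace C0Semigroup

variable {H : Type*} [NormedAddCommGroup H]

theorem continuous_orbit [NormedSpace ℝ H] (S : C0Semigroup H) (x : H) :
    Continuous fun u : ℝ => S.op u.toNNReal x :=
  (S.strongly_continuous x).comp continuous_real_toNNReal

/-- Integrals of orbits belong to the domain of the generator. -/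
theorem tendsto_quot_integral_orbit [NormedSpace ℝ H] [CompleteSpace H] (S : C0Semigroup H) (x : H)
    (r : ℝ≥0) :
    Tendsto (S.quot (∫ u in (0 : ℝ)..r, S.op u.toNNReal x)) (𝓝[>] 0) (𝓝 (S.op r x - x)) := by
  set F : ℝ → H := fun t => ∫ u in (0 : ℝ)..t, S.op u.toNNReal x with hF
  have hcont := S.continuous_orbit x
  have hint : ∀ a b : ℝ, IntervalIntegrable (fun u : ℝ => S.op u.toNNReal x) volume a b :=
    fun a b => hcont.intervalIntegrable a b
  have hderiv : ∀ t : ℝ, HasDerivAt F (S.op t.toNNReal x) t := fun t =>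
    intervalIntegral.integral_hasDerivAt_right (hint 0 t)
      (hcont.stronglyMeasurableAtFilter _ _) hcont.continuousAt
  have hcoe : Tendsto (fun h : ℝ≥0 => (h : ℝ)) (𝓝[>] 0) (𝓝[≠] 0) := by
    refine tendsto_nhdsWithin_iff.2 ⟨?_, ?_⟩
    · exact (NNReal.continuous_coe.tendsto' 0 0 rfl).mono_left nhdsWithin_le_nhds
    · filter_upwards [self_mem_nhdsWithin] with h hh
      exact (NNReal.coe_pos.2 hh).ne'
  have h1 := (hasDerivAt_iff_tendsto_slope_zero.1 (hderiv r)).comp hcoe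
  have h2 := (hasDerivAt_iff_tendsto_slope_zero.1 (hderiv 0)).comp hcoe
  have h3 := h1.sub h2
  simp only [Real.toNNReal_coe, Real.toNNReal_zero, S.op_zero, ContinuousLinearMap.id_apply] at h3
  refine h3.congr fun h => ?_
  -- By the semigroup law, `S(h)` shifts the interval of integration, so the quotient is the slope
  -- of `F` at `r` minus its slope at `0`.
  have hshift : S.op h (F r) = F (r + h) - F h := by
    simp only [hF]
    rw [← ContinuousLinearMap.intervalIntegral_comp_comm _ (hint _ _),
      intervalIntegral.integral_interval_sub_left (hint _ _) (hint _ _)]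
    have := intervalIntegral.integral_comp_add_right
      (fun u : ℝ => S.op u.toNNReal x) (h : ℝ) (a := 0) (b := r)
    rw [zero_add] at this
    rw [← this]
    refine intervalIntegral.integral_congr fun u hu => ?_
    rw [Set.uIcc_of_le r.coe_nonneg] at hu
    have : (u + h).toNNReal = h + u.toNNReal := by
      rw [Real.toNNReal_add hu.1 h.coe_nonneg, Real.toNNReal_coe, add_comm]
    simp only [this, S.op_add, ContinuousLinearMap.comp_apply]
  have hF0 : F 0 = 0 := by simp [hF]
  simp only [Function.comp_apply, quot]
  rw [← smul_sub, zero_add, hF0]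
  change _ = (h : ℝ)⁻¹ • (S.op h (F r) - F r)
  rw [hshift]
  congr 1
  abel

/-- For `y` in the domain of the adjoint of the generator, `r ↦ ⟪y, S(r) x⟫` is continuously
differentiable. -/
theorem exists_inner_orbit_eq_integral [InnerProductSpace ℝ H] [CompleteSpace H]
    (S : C0Semigroup H) {y : H} (hy : y ∈ S.generator.adjoint.domain) (x : H) :
    ∃ G : ℝ → ℝ, Continuous G ∧
      ∀ r : ℝ≥0, inner ℝ y (S.op r x) = inner ℝ y x + ∫ u in (0 : ℝ)..r, G u := by
  -- Hahn–Banach extends `z ↦ ⟨y, A z⟩` to all of `H`, so density of the domain of `A` is not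
  -- needed. The derivative is then `u ↦ φ (S(u) x)`.
  obtain ⟨φ, hφ, -⟩ := exists_extension_norm_eq S.generator.domain
    (S.generator.adjointDomainMkCLM ⟨y, hy⟩)
  refine ⟨fun u => φ (S.op u.toNNReal x), φ.continuous.comp (S.continuous_orbit x), fun r => ?_⟩
  rw [ContinuousLinearMap.intervalIntegral_comp_comm φ
    ((S.continuous_orbit x).intervalIntegrable 0 r)]
  have hlim := S.tendsto_quot_integral_orbit x r
  have hA : S.generator ⟨_, ⟨_, hlim⟩⟩ = S.op r x - x := hlim.limUnder_eq
  have h := hφ ⟨∫ u in (0 : ℝ)..r, S.op u.toNNReal x, ⟨_, hlim⟩⟩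
  rw [LinearPMap.adjointDomainMkCLM_apply, hA, inner_sub_right] at h
  change φ (∫ u in (0 : ℝ)..r, S.op u.toNNReal x) = _ at h
  rw [h]
  ring

end C0Semigroup

/-! ### Oscillation of paths -/

/-- If `f` jumps by more than `δ` at `s`, then `f` oscillates by more than `δ` over points of a
dense set that are arbitrarily close to `s`. -/
theorem IsCadlag.exists_oscillation_of_jump {f : ℝ≥0 → ℝ} (hf : IsCadlag f) {D : Set ℝ≥0}
    (hD : Dense D) {s : ℝ≥0} {δ : ℝ} (h : δ < |jump f s|) {a b : ℝ≥0} (ha : a < s)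
    (hb : s < b) : ∃ q ∈ D, ∃ q' ∈ D, q ∈ Set.Ioo a s ∧ q' ∈ Set.Ioo s b ∧ δ < |f q - f q'| := by
  obtain ⟨hr, l, hl⟩ := hf s
  have : (𝓝[<] s).NeBot := nhdsLT_neBot_of_exists_lt ⟨a, ha⟩
  rw [jump, leftLim_eq_of_tendsto hl] at h
  set η := (|f s - l| - δ) / 2 with hη
  have hη0 : 0 < η := by linarith
  have h1 : ∀ᶠ x in 𝓝[<] s, |f x - l| < η := by
    filter_upwards [hl (Metric.ball_mem_nhds _ hη0)] with x hx using by simpa [Real.dist_eq] using hx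
  have h2 : ∀ᶠ x in 𝓝[>] s, |f x - f s| < η := by
    have : Tendsto f (𝓝[>] s) (𝓝 (f s)) :=
      hr.tendsto.mono_left (nhdsWithin_mono _ Set.Ioi_subset_Ici_self)
    filter_upwards [this (Metric.ball_mem_nhds _ hη0)] with x hx using by simpa [Real.dist_eq] using hx
  obtain ⟨a', ha', ha''⟩ := (mem_nhdsLT_iff_exists_Ioo_subset' ha).1 h1
  obtain ⟨b', hb', hb''⟩ := mem_nhdsGT_iff_exists_Ioo_subset.1 h2
  obtain ⟨q, hqD, hq⟩ := hD.exists_between (max_lt ha ha')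
  obtain ⟨q', hqD', hq'⟩ := hD.exists_between (lt_min hb hb')
  have hq1 : |f q - l| < η := ha'' ⟨(le_max_right _ _).trans_lt hq.1, hq.2⟩
  have hq2 : |f q' - f s| < η := hb'' ⟨hq'.1, hq'.2.trans_le (min_le_right _ _)⟩
  refine ⟨q, hqD, q', hqD', ⟨(le_max_left _ _).trans_lt hq.1, hq.2⟩,
    ⟨hq'.1, hq'.2.trans_le (min_le_left _ _)⟩, ?_⟩
  have : |f s - l| ≤ |f q - f q'| + |f q - l| + |f q' - f s| := by
    have e1 : f s - l = -(f q - f q') + (f q - l) + -(f q' - f s) := by ring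
    rw [e1]
    refine (abs_add_three _ _ _).trans ?_
    rw [abs_neg, abs_neg]
  linarith

/-- The set of paths that oscillate by more than `δ` over arbitrarily close points of `T`. -/
def oscillating (T : Set ℝ≥0) (δ : ℝ) : Set (ℝ≥0 → ℝ) :=
  {w | ∀ n : ℕ, ∃ q q' : T, dist (q : ℝ≥0) q' < 1 / ((n : ℝ) + 1) ∧ δ < |w q - w q'|}

theorem measurableSet_oscillating {T : Set ℝ≥0} (hT : T.Countable) (δ : ℝ) :
    MeasurableSet (oscillating T δ) := by
  have := hT.to_subtype
  have : oscillating T δ = ⋂ n : ℕ, ⋃ q : T, ⋃ q' : T,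
      {w : ℝ≥0 → ℝ | dist (q : ℝ≥0) q' < 1 / ((n : ℝ) + 1) ∧ δ < |w q - w q'|} := by
    ext w; simp [oscillating]
  rw [this]
  refine MeasurableSet.iInter fun n => MeasurableSet.iUnion fun q => MeasurableSet.iUnion fun q' =>
    (MeasurableSet.const _).inter (measurableSet_lt (f := fun _ => δ) measurable_const ?_)
  have : Measurable fun w : ℝ≥0 → ℝ => w q - w q' :=
    (measurable_pi_apply _).sub (measurable_pi_apply _)
  exact _root_.continuous_abs.measurable.comp this

/-- The cutoff `2` leaves room to the right of a jump at time `1`. -/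
theorem IsCadlag.mem_oscillating_of_jump {f : ℝ≥0 → ℝ} (hf : IsCadlag f) {D : Set ℝ≥0}
    (hD : Dense D) {s : ℝ≥0} (hs : s ∈ Set.Ioc 0 1) {δ : ℝ} (h : δ < |jump f s|) :
    f ∈ oscillating (D ∩ Set.Iio 2) δ := by
  intro n
  have hn : (0 : ℝ) < 1 / ((n : ℝ) + 1) := by positivity
  set ρ : ℝ≥0 := (1 / ((n : ℝ) + 1) / 2).toNNReal with hρ
  have hρ' : (ρ : ℝ) = 1 / ((n : ℝ) + 1) / 2 := Real.coe_toNNReal _ (by positivity)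
  have hρ0 : 0 < ρ := by rw [← NNReal.coe_pos, hρ']; positivity
  obtain ⟨q, hq, q', hq', h1, h2, h3⟩ := hf.exists_oscillation_of_jump hD h
    (a := s - ρ) (b := min (s + ρ) 2) (tsub_lt_self hs.1 hρ0)
    (lt_min (lt_add_of_pos_right _ hρ0) (hs.2.trans_lt one_lt_two))
  have hb2 := h2.2.trans_le (min_le_right _ _)
  refine ⟨⟨q, hq, (h1.2.trans h2.1).trans hb2⟩, ⟨q', hq', hb2⟩, ?_, h3⟩
  have e1 : (s : ℝ) < q + ρ := by
    exact_mod_cast lt_add_of_tsub_lt_right h1.1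
  have e2 : (q' : ℝ) < s + ρ := by exact_mod_cast h2.2.trans_le (min_le_left _ _)
  have e3 : (q : ℝ) < q' := by exact_mod_cast h1.2.trans h2.1
  rw [NNReal.dist_eq, abs_sub_lt_iff]
  constructor <;> linarith

/-- An oscillating path stays away from every path that is continuous at a certain point. -/
theorem exists_forall_continuousAt_of_mem_oscillating {T : Set ℝ≥0} {a : ℝ≥0}
    (hT : T ⊆ Set.Iic a) {δ : ℝ} {w : ℝ≥0 → ℝ} (hw : w ∈ oscillating T δ) :
    ∃ s, ∀ v : ℝ≥0 → ℝ, ContinuousAt v s → ∀ η < δ, ∃ q ∈ T, η / 2 < |w q - v q| := by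
  choose q q' hqq' hδ using hw
  -- The point `s` is a cluster point of the oscillation times. It depends on `w` alone, so `v` may
  -- later be an independent random path.
  obtain ⟨s, -, φ, hφ, hs⟩ := (isCompact_Icc (a := (0 : ℝ≥0)) (b := a)).tendsto_subseq
    (x := fun n => (q n : ℝ≥0)) fun n => ⟨zero_le, hT (q n).2⟩
  have hs' : Tendsto (fun n => (q' (φ n) : ℝ≥0)) atTop (𝓝 s) := by
    refine hs.congr_dist ?_
    refine squeeze_zero (fun _ => dist_nonneg) (fun n => (hqq' (φ n)).le) ?_
    exact tendsto_one_div_add_atTop_nhds_zero_nat.comp hφ.tendsto_atTop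
  refine ⟨s, fun v hv η hη => ?_⟩
  by_contra! hcon
  have hlim : Tendsto (fun n => η + |v (q (φ n)) - v (q' (φ n))|) atTop (𝓝 (η + |v s - v s|)) :=
    tendsto_const_nhds.add ((hv.tendsto.comp hs).sub (hv.tendsto.comp hs')).abs
  have hle : δ ≤ η + |v s - v s| := by
    refine ge_of_tendsto' hlim fun n => ?_
    have h1 := hcon _ (q (φ n)).2
    have h2 := hcon _ (q' (φ n)).2
    have h3 := hδ (φ n)
    rw [abs_le] at h1 h2
    refine h3.le.trans ?_
    rw [abs_le]
    have h4 := abs_le.1 (le_refl |v (q (φ n)) - v (q' (φ n))|)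
    constructor <;> linarith [h1.1, h1.2, h2.1, h2.2, h4.1, h4.2]
  simp at hle
  linarith

/-! ### Lévy processes -/

/-- A Lévy process has no fixed times of discontinuity. -/
theorem IsCadlagLevyProcess.ae_continuousAt {Ω : Type*} {mΩ : MeasurableSpace Ω} {P : Measure Ω}
    [IsFiniteMeasure P] {Z : ℝ≥0 → Ω → ℝ} (hZ : IsCadlagLevyProcess Z P) (s : ℝ≥0) :
    ∀ᵐ ω ∂P, ContinuousAt (fun t => Z t ω) s := by
  rcases eq_or_ne s 0 with rfl | hs
  · filter_upwards [hZ.cadlag] with ω hω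
    have := (hω 0).1
    rwa [show Set.Ici (0 : ℝ≥0) = Set.univ from Set.Ici_bot, continuousWithinAt_univ] at this
  have hs0 : 0 < s := pos_iff_ne_zero.2 hs
  let h : ℕ → ℝ≥0 := fun n => s / ((n : ℝ≥0) + 1)
  have hpos : ∀ n, 0 < h n := fun n => by positivity
  have hle : ∀ n, h n ≤ s := fun n => div_le_self zero_le (by simp)
  have hh0 : Tendsto h atTop (𝓝 0) := by
    have := (tendsto_const_div_atTop_nhds_zero_nat s).comp (tendsto_add_atTop_nat 1)
    refine this.congr fun n => by simp [h]
  have hleft : Tendsto (fun n => s - h n) atTop (𝓝[<] s) := by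
    refine tendsto_nhdsWithin_iff.2 ⟨?_, Eventually.of_forall fun n => tsub_lt_self hs0 (hpos n)⟩
    simpa using (tendsto_const_nhds (x := s)).sub hh0
  have hinc : TendstoInMeasure P (fun n ω => Z (h n) ω - Z 0 ω) atTop (fun _ => 0) := by
    refine tendstoInMeasure_of_tendsto_ae
      (fun n => ((hZ.measurable _).sub (hZ.measurable _)).aestronglyMeasurable) ?_
    filter_upwards [hZ.cadlag] with ω hω
    have h0 := (hω 0).1
    rw [show Set.Ici (0 : ℝ≥0) = Set.univ from Set.Ici_bot, continuousWithinAt_univ] at h0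
    simpa using (h0.tendsto.comp hh0).sub_const (Z 0 ω)
  -- By stationarity, increments ending at `s` have the law of increments starting at `0`, which
  -- vanish by right-continuity. Hence the left limit at `s` is `Z s`.
  have hinc' : TendstoInMeasure P (fun n ω => Z s ω - Z (s - h n) ω) atTop (fun _ => 0) := by
    intro ε hε
    refine (hinc ε hε).congr fun n => ?_
    have hid := hZ.stationaryIncrements (s - h n) (h n)
    simp only [tsub_add_cancel_of_le (hle n)] at hid
    exact (hid.measure_mem_eq (s := {x : ℝ | ε ≤ edist x 0})
      (measurableSet_le measurable_const (by fun_prop))).symm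
  obtain ⟨ns, hns, hae⟩ := hinc'.exists_seq_tendsto_ae
  filter_upwards [hZ.cadlag, hae] with ω hω hω'
  obtain ⟨hr, l, hl⟩ := hω s
  have hlim : Tendsto (fun i => Z s ω - Z (s - h (ns i)) ω) atTop (𝓝 (Z s ω - l)) :=
    tendsto_const_nhds.sub ((hl.comp hleft).comp hns.tendsto_atTop)
  have hl' : l = Z s ω := (sub_eq_zero.1 (tendsto_nhds_unique hlim hω')).symm
  rw [hl'] at hl
  rw [ContinuousAt, ← nhdsLT_sup_nhdsGE s]
  exact hl.sup hr

/-- If the jump intensity of a Lévy process does not vanish, then its paths are oscillating with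
positive probability. -/
theorem IsJumpIntensity.exists_measure_oscillating_pos {Ω : Type*} {mΩ : MeasurableSpace Ω}
    {P : Measure Ω} {Z : ℝ≥0 → Ω → ℝ} (hZ : IsCadlagLevyProcess Z P) {ν : Measure ℝ}
    (hν : IsJumpIntensity Z P ν) (hν0 : ν ≠ 0) {D : Set ℝ≥0} (hD : Dense D) :
    ∃ δ > 0, P ((fun ω t => Z t ω) ⁻¹' oscillating (D ∩ Set.Iio 2) δ) ≠ 0 := by
  by_contra! hcon
  apply hν0
  rw [← Measure.measure_univ_eq_zero, hν _ MeasurableSet.univ, lintegral_congr_ae (g := 0)]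
  · simp
  have hall : ∀ᵐ ω ∂P, ∀ n : ℕ,
      (fun t => Z t ω) ∉ oscillating (D ∩ Set.Iio 2) (1 / ((n : ℝ) + 1)) :=
    ae_all_iff.2 fun n => measure_eq_zero_iff_ae_notMem.1 (hcon _ (by positivity))
  filter_upwards [hall, hZ.cadlag] with ω hω hc
  have : {s : ℝ≥0 | s ∈ Set.Ioc 0 1 ∧ jump (fun t => Z t ω) s ≠ 0 ∧
      jump (fun t => Z t ω) s ∈ Set.univ} = ∅ := by
    rw [Set.eq_empty_iff_forall_notMem]
    rintro s ⟨hs, hj, -⟩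
    obtain ⟨n, hn⟩ := exists_nat_one_div_lt (abs_pos.2 hj)
    exact hω n (hc.mem_oscillating_of_jump hD hs hn)
  rw [this]
  simp

/-! ### Limits in measure, symmetrization -/

/-- An almost surely convergent subsequence has an `m`-measurable `limUnder`. Such versions allow
independence of σ-algebras to be used without completing them. -/
theorem exists_measurable_ae_eq_of_tendstoInMeasure {Ω E : Type*} {m mΩ : MeasurableSpace Ω}
    {P : Measure Ω} [PseudoEMetricSpace E] {f : ℕ → Ω → E} {g : Ω → E}
    (h : TendstoInMeasure P f atTop g) {φ : E → ℝ} (hφ : Continuous φ)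
    (hf : ∀ k, Measurable[m] fun ω => φ (f k ω)) :
    ∃ g' : Ω → ℝ, Measurable[m] g' ∧ (fun ω => φ (g ω)) =ᵐ[P] g' := by
  obtain ⟨ns, -, hae⟩ := h.exists_seq_tendsto_ae
  refine ⟨fun ω => limUnder atTop fun k => φ (f (ns k) ω), ?_, ?_⟩
  · exact (@StronglyMeasurable.limUnder ℕ Ω ℝ m _ _ atTop _ _ _ _
      fun k => (hf (ns k)).stronglyMeasurable).measurable
  · filter_upwards [hae] with ω hω
    exact ((hφ.tendsto _).comp hω).limUnder_eq.symm

theorem ae_eq_of_tendstoInMeasure_of_tendsto_ae {Ω E : Type*} {mΩ : MeasurableSpace Ω}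
    {P : Measure Ω} [PseudoEMetricSpace E] {f : ℕ → Ω → E} {g : Ω → E}
    (h : TendstoInMeasure P f atTop g) {φ : E → ℝ} (hφ : Continuous φ) {g' : Ω → ℝ}
    (hg' : ∀ᵐ ω ∂P, Tendsto (fun k => φ (f k ω)) atTop (𝓝 (g' ω))) :
    (fun ω => φ (g ω)) =ᵐ[P] g' := by
  obtain ⟨ns, hns, hae⟩ := h.exists_seq_tendsto_ae
  filter_upwards [hae, hg'] with ω h1 h2
  exact tendsto_nhds_unique ((hφ.tendsto _).comp h1) (h2.comp hns.tendsto_atTop)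

/-- A symmetrization inequality for the supremum of a sum of two independent families. -/
theorem measure_prod_exists_lt_abs_sub_le {Ω ι : Type*} {mΩ : MeasurableSpace Ω} {P : Measure Ω}
    [IsProbabilityMeasure P] [Countable ι] {U R : ι → Ω → ℝ} (hU : ∀ i, Measurable (U i))
    (hR : ∀ i, Measurable (R i))
    (hind : IndepFun (fun ω i => U i ω) (fun ω i => R i ω) P) (c : ℝ) :
    P.prod P {z | ∃ i, 2 * c < |U i z.1 - U i z.2|} ≤ 2 * P {ω | ∃ i, c < |U i ω + R i ω|} := by
  set u : Ω → ι → ℝ := fun ω i => U i ω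
  set r : Ω → ι → ℝ := fun ω i => R i ω
  have hu : Measurable u := measurable_pi_lambda _ hU
  have hr : Measurable r := measurable_pi_lambda _ hR
  have : IsProbabilityMeasure (P.map u) := Measure.isProbabilityMeasure_map hu.aemeasurable
  have : IsProbabilityMeasure (P.map r) := Measure.isProbabilityMeasure_map hr.aemeasurable
  set μ := P.map u
  set ρ := P.map r
  let A : Set ((ι → ℝ) × (ι → ℝ)) := {p | ∃ i, c < |p.1 i + p.2 i|}
  let B : Set ((ι → ℝ) × (ι → ℝ)) := {p | ∃ i, 2 * c < |p.1 i - p.2 i|}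
  have hA : MeasurableSet A := by
    simp only [A, Set.ofPred_exists]
    exact MeasurableSet.iUnion fun i => measurableSet_lt (f := fun _ => c) measurable_const
      (_root_.continuous_abs.measurable.comp (by fun_prop))
  have hB : MeasurableSet B := by
    simp only [B, Set.ofPred_exists]
    exact MeasurableSet.iUnion fun i => measurableSet_lt (f := fun _ => 2 * c) measurable_const
      (_root_.continuous_abs.measurable.comp (by fun_prop))
  have h1 : P {ω | ∃ i, c < |U i ω + R i ω|} = μ.prod ρ A := by
    rw [← (indepFun_iff_map_prod_eq_prod_map_map hu.aemeasurable hr.aemeasurable).1 hind,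
      Measure.map_apply (hu.prodMk hr) hA]
    rfl
  have h2 : P.prod P {z | ∃ i, 2 * c < |U i z.1 - U i z.2|} = μ.prod μ B := by
    rw [Measure.map_prod_map P P hu hu, Measure.map_apply (hu.prodMap hu) hB]
    rfl
  -- With the value `y` of the second family frozen, a difference above `2 * c` forces one of the
  -- two shifted copies above `c`; the union bound gives the factor `2`.
  have hslice : ∀ y, μ.prod μ B ≤ 2 * μ ((fun x => (x, y)) ⁻¹' A) := by
    intro y
    set Ay := (fun x => (x, y)) ⁻¹' A
    have hsub : B ⊆ Ay ×ˢ Set.univ ∪ Set.univ ×ˢ Ay := by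
      rintro ⟨x, x'⟩ ⟨i, hi⟩
      by_contra hcon
      simp only [Set.mem_union, Set.mem_prod, Set.mem_univ, and_true, true_and, not_or] at hcon
      have e1 : |x i + y i| ≤ c := not_lt.1 fun h => hcon.1 ⟨i, h⟩
      have e2 : |x' i + y i| ≤ c := not_lt.1 fun h => hcon.2 ⟨i, h⟩
      have e3 : x i - x' i = (x i + y i) - (x' i + y i) := by ring
      have e4 := abs_sub (x i + y i) (x' i + y i)
      rw [← e3] at e4
      simp only at hi
      linarith
    refine (measure_mono hsub).trans ((measure_union_le _ _).trans ?_)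
    rw [Measure.prod_prod, Measure.prod_prod, measure_univ, mul_one, one_mul, two_mul]
  rw [h1, h2, Measure.prod_apply_symm hA,
    ← lintegral_const_mul _ (measurable_measure_prodMk_right hA)]
  calc μ.prod μ B = ∫⁻ _, μ.prod μ B ∂ρ := by simp
    _ ≤ _ := lintegral_mono hslice

theorem measure_le_measure_prod {Ω Ω' : Type*} {mΩ : MeasurableSpace Ω} {mΩ' : MeasurableSpace Ω'}
    {P : Measure Ω} {P' : Measure Ω'} [IsProbabilityMeasure P'] {K : Set Ω}
    (hK : MeasurableSet K) {B : Set (Ω × Ω')} (hB : MeasurableSet B)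
    (h : ∀ᵐ ω ∂P, ω ∈ K → ∀ᵐ ω' ∂P', (ω, ω') ∈ B) : P K ≤ P.prod P' B := by
  rw [Measure.prod_apply hB, ← lintegral_indicator_one hK]
  refine lintegral_mono_ae ?_
  filter_upwards [h] with ω hω
  by_cases hωK : ω ∈ K
  · rw [Set.indicator_of_mem hωK, Pi.one_apply]
    have : (Prod.mk ω ⁻¹' B : Set Ω') =ᵐ[P'] Set.univ := eventuallyEq_univ.2 (hω hωK)
    rw [measure_congr this, measure_univ]
  · simp [hωK]

/-! ### Coordinates of a càdlàg process in a Hilbert space -/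

/-- By Bessel, the coordinates of the finitely many centres of a `c / 2`-net tend to `0`, and
passing to a centre costs at most `c / 2`. -/
theorem eventually_forall_abs_inner_le {H : Type*} [NormedAddCommGroup H] [InnerProductSpace ℝ H]
    {e : ℕ → H} (he : Orthonormal ℝ e) {K : Set H} (hK : TotallyBounded K) {c : ℝ} (hc : 0 < c) :
    ∀ᶠ m in atTop, ∀ y ∈ K, |inner ℝ (e m) y| ≤ c := by
  obtain ⟨t, ht, hKt⟩ := Metric.totallyBounded_iff.1 hK (c / 2) (half_pos hc)
  have h : ∀ y ∈ t, ∀ᶠ m in atTop, |inner ℝ (e m) y| < c / 2 := by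
    intro y _
    have h1 := (he.inner_products_summable y).tendsto_atTop_zero
    have h2 := h1.eventually_lt_const (pow_pos (half_pos hc) 2)
    filter_upwards [h2] with m hm
    exact lt_of_pow_lt_pow_left₀ 2 (half_pos hc).le hm
  filter_upwards [ht.eventually_all.2 h] with m hm y hy
  obtain ⟨z, hz, hyz⟩ := Set.mem_iUnion₂.1 (hKt hy)
  have h1 : |inner ℝ (e m) (y - z)| ≤ ‖y - z‖ := by
    simpa [he.1 m] using abs_real_inner_le_norm (e m) (y - z)
  have h2 : ‖y - z‖ < c / 2 := by rwa [← dist_eq_norm]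
  have h3 : inner ℝ (e m) y = inner ℝ (e m) (y - z) + inner ℝ (e m) z := by
    rw [← inner_add_right, sub_add_cancel]
  rw [h3]
  refine (abs_add_le _ _).trans ?_
  linarith [hm z hz]

/-- The coordinates of a process with a càdlàg modification tend to zero in probability, uniformly
over bounded countable sets of times. -/
theorem IsCadlagModification.tendsto_measure_exists_lt {Ω H : Type*} {mΩ : MeasurableSpace Ω}
    {P : Measure Ω} [IsFiniteMeasure P] [NormedAddCommGroup H] [InnerProductSpace ℝ H]
    {e : ℕ → H} (he : Orthonormal ℝ e) {X Y : ℝ≥0 → Ω → H} (hY : IsCadlagModification P X Y)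
    {T : Set ℝ≥0} (hT : T.Countable) {a : ℝ≥0} (ha : T ⊆ Set.Iic a) {V : ℕ → T → Ω → ℝ}
    (hV : ∀ m t, Measurable (V m t))
    (hVX : ∀ m (t : T), (fun ω => inner ℝ (e m) (X t ω)) =ᵐ[P] V m t) {c : ℝ} (hc : 0 < c) :
    Tendsto (fun m => P {ω | ∃ t, c < |V m t ω|}) atTop (𝓝 0) := by
  have := hT.to_subtype
  have hmeas : ∀ m, MeasurableSet {ω | ∃ t, c < |V m t ω|} := fun m => by
    simp only [Set.ofPred_exists]
    exact MeasurableSet.iUnion fun t => measurableSet_lt (f := fun _ => c) measurable_const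
      (_root_.continuous_abs.measurable.comp (hV m t))
  have h := tendsto_measure_of_ae_tendsto_indicator (μ := P) (A := ∅) (B := Set.univ) atTop
    MeasurableSet.empty hmeas MeasurableSet.univ (measure_ne_top _ _)
    (Eventually.of_forall fun _ => Set.subset_univ _) ?_
  · simpa using h
  have h1 : ∀ᵐ ω ∂P, ∀ t : T, Y t ω = X t ω := ae_all_iff.2 fun t => hY.1 t
  have h2 : ∀ᵐ ω ∂P, ∀ m, ∀ t : T, inner ℝ (e m) (X t ω) = V m t ω :=
    ae_all_iff.2 fun m => ae_all_iff.2 fun t => hVX m t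
  filter_upwards [h1, h2, hY.2] with ω h1 h2 hcad
  filter_upwards [eventually_forall_abs_inner_le he
    (hcad.totallyBounded_image (isCompact_Icc (a := 0) (b := a))) hc] with m hm
  simp only [Set.mem_empty_iff_false, iff_false, not_exists, not_lt]
  intro t
  rw [← h2, ← h1]
  exact hm _ ⟨t, ⟨zero_le, ha t.2⟩, rfl⟩

/-! ### Coordinates of the stochastic convolution -/

section Coordinates

variable {H : Type*} [NormedAddCommGroup H] [InnerProductSpace ℝ H] {Ω : Type*}

theorem inner_riemannSum (Z : ℝ≥0 → ℝ) (t : ℝ≥0) (f : ℝ≥0 → H) (y : H) (N : ℕ) :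
    inner ℝ y (∑ k ∈ Finset.range N,
      (Z (t * ((k : ℝ≥0) + 1) / N) - Z (t * (k : ℝ≥0) / N)) • f (t * (k : ℝ≥0) / N)) =
    ∑ k ∈ Finset.range N, (Z (t * ((k : ℝ≥0) + 1) / N) - Z (t * (k : ℝ≥0) / N)) *
      inner ℝ y (f (t * (k : ℝ≥0) / N)) := by
  rw [inner_sum]
  simp only [inner_smul_right]

/-- The coordinates of a stochastic integral are functionals of the integrator. -/
theorem IsStochasticIntegral.exists_measurable_inner {m mΩ : MeasurableSpace Ω} {P : Measure Ω}
    {Z : ℝ≥0 → Ω → ℝ} {t : ℝ≥0} {f : ℝ≥0 → H} {I : Ω → H} (h : IsStochasticIntegral P Z t f I)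
    (hZ : ∀ t, Measurable[m] (Z t)) (y : H) :
    ∃ j : Ω → ℝ, Measurable[m] j ∧ (fun ω => inner ℝ y (I ω)) =ᵐ[P] j := by
  refine exists_measurable_ae_eq_of_tendstoInMeasure h (φ := fun x => inner ℝ y x) (by fun_prop)
    fun N => ?_
  refine (congrArg (Measurable[m] ·)
    (funext fun ω => inner_riemannSum (fun t => Z t ω) t f y N)).mpr ?_
  exact Finset.measurable_fun_sum _ fun k _ => ((hZ _).sub (hZ _)).mul_const _

/-- Integration by parts for the coordinates of `∫₀ᵗ S(t - s) y dZ(s)`. -/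
theorem IsStochasticIntegral.inner_ae_eq [CompleteSpace H] {mΩ : MeasurableSpace Ω}
    {P : Measure Ω} {Z : ℝ≥0 → Ω → ℝ} (hZ : IsCadlagLevyProcess Z P) {S : C0Semigroup H} {x y : H}
    {G : ℝ → ℝ} (hG : Continuous G)
    (hS : ∀ r : ℝ≥0, inner ℝ y (S.op r x) = inner ℝ y x + ∫ u in (0 : ℝ)..r, G u) {t : ℝ≥0}
    {I : Ω → H} (h : IsStochasticIntegral P Z t (fun s => S.op (t - s) x) I) :
    (fun ω => inner ℝ y (I ω)) =ᵐ[P]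
      fun ω => inner ℝ y x * Z t ω + pathConv G (fun s => Z s ω) t := by
  refine ae_eq_of_tendstoInMeasure_of_tendsto_ae h (φ := fun x => inner ℝ y x) (by fun_prop) ?_
  filter_upwards [hZ.cadlag, hZ.zero] with ω hc h0
  exact (tendsto_riemannSum hG (g := fun r => inner ℝ y (S.op r x)) hS hc h0 t).congr fun N =>
    (inner_riemannSum (fun t => Z t ω) t (fun s => S.op (t - s) x) y N).symm

theorem exists_indep_of_iIndep {mΩ : MeasurableSpace Ω} {P : Measure Ω}
    {𝓛 : ℕ → MeasurableSpace Ω} (h𝓛 : ∀ n, 𝓛 n ≤ mΩ) (h : iIndep 𝓛 P) (m : ℕ) :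
    ∃ 𝓡 : MeasurableSpace Ω, 𝓡 ≤ mΩ ∧ Indep (𝓛 m) 𝓡 P ∧ ∀ n, n ≠ m → 𝓛 n ≤ 𝓡 := by
  refine ⟨⨆ n ∈ ({m} : Set ℕ)ᶜ, 𝓛 n, iSup₂_le fun n _ => h𝓛 n, ?_,
    fun n hn => le_iSup₂_of_le n hn le_rfl⟩
  have := indep_iSup_of_disjoint h𝓛 h (disjoint_compl_right (a := ({m} : Set ℕ)))
  rwa [iSup_singleton] at this

/-- Each coordinate of the stochastic convolution is the sum of a contribution of the driving
process of the same index, and of an independent one. -/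
theorem IsStochasticConvolution.exists_independent_decomposition [CompleteSpace H]
    {mΩ : MeasurableSpace Ω} {P : Measure Ω} [IsProbabilityMeasure P] {S : C0Semigroup H}
    {e : HilbertBasis ℕ ℝ H} {β : ℕ → ℝ} {L : ℕ → ℝ≥0 → Ω → ℝ} {X : ℝ≥0 → Ω → H}
    (hX : IsStochasticConvolution P S e β L X) (hL : ∀ n, IsCadlagLevyProcess (L n) P)
    (hind : iIndepFun (fun n ω t => L n t ω) P) {m : ℕ}
    (he : e m ∈ S.generator.adjoint.domain) :
    ∃ G : ℝ → ℝ, Continuous G ∧ ∃ U R : ℝ≥0 → Ω → ℝ, (∀ t, Measurable (U t)) ∧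
      (∀ t, Measurable (R t)) ∧ IndepFun (fun ω t => U t ω) (fun ω t => R t ω) P ∧
      (∀ t, (fun ω => inner ℝ (e m) (X t ω)) =ᵐ[P] fun ω => U t ω + R t ω) ∧
      ∀ t, U t =ᵐ[P] fun ω => β m * (L m t ω + pathConv G (fun s => L m s ω) t) := by
  obtain ⟨G, hG, hS⟩ := S.exists_inner_orbit_eq_integral he (e m)
  have hem : inner ℝ (e m) (e m) = 1 := by
    rw [real_inner_self_eq_norm_sq, e.orthonormal.1 m, one_pow]
  let 𝓛 : ℕ → MeasurableSpace Ω := fun n =>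
    MeasurableSpace.comap (fun ω t => L n t ω) MeasurableSpace.pi
  have h𝓛 : ∀ n, 𝓛 n ≤ mΩ := fun n =>
    (measurable_pi_lambda _ (hL n).measurable).comap_le
  have hLm : ∀ n t, Measurable[𝓛 n] (L n t) := fun n t =>
    (measurable_pi_apply t).comp (comap_measurable (fun ω t => L n t ω))
  choose J hJ hJX using hX
  have hj : ∀ t n, ∃ j : Ω → ℝ, Measurable[𝓛 n] j ∧
      (fun ω => inner ℝ (e m) (J t n ω)) =ᵐ[P] j := fun t n =>
    (hJ t n).exists_measurable_inner (hLm n) (e m)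
  choose j hjm hjJ using hj
  obtain ⟨𝓡, h𝓡le, hindep, h𝓛𝓡⟩ :=
    exists_indep_of_iIndep h𝓛 ((iIndepFun_iff_iIndep _ _ _).1 hind) m
  have hU : ∀ t, Measurable[𝓛 m] fun ω => β m * j t m ω := fun t =>
    (hjm t m).const_mul _
  -- Once `N > m`, deleting the `m`-th term leaves partial sums measurable for the σ-algebra of the
  -- other drivers.
  have hR : ∀ t, ∃ R : Ω → ℝ, Measurable[𝓡] R ∧
      (fun ω => inner ℝ (e m) (X t ω) - β m * j t m ω) =ᵐ[P] R := by
    intro t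
    refine exists_measurable_ae_eq_of_tendstoInMeasure
      (f := fun (N : ℕ) ω => ∑ n ∈ (Finset.range N).erase m, β n * j t n ω) (φ := id) ?_
      continuous_id fun N => ?_
    · intro ε hε
      refine (hJX t m ε hε).congr' ?_
      filter_upwards [eventually_gt_atTop m] with N hN
      refine measure_congr ?_
      have hall : ∀ᵐ ω ∂P, ∀ n, inner ℝ (e m) (J t n ω) = j t n ω :=
        ae_all_iff.2 fun n => hjJ t n
      filter_upwards [hall] with ω hω
      have hsum : ∑ n ∈ Finset.range N, β n * inner ℝ (e m) (J t n ω) - β m * j t m ω =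
          ∑ n ∈ (Finset.range N).erase m, β n * j t n ω := by
        simp only [hω]
        rw [← Finset.add_sum_erase _ _ (Finset.mem_range.2 hN)]
        ring
      refine propext ?_
      change ε ≤ _ ↔ ε ≤ _
      rw [← hsum, edist_sub_right]
    · refine Finset.measurable_fun_sum _ fun n hn => Measurable.const_mul ?_ _
      exact (hjm t n).mono (h𝓛𝓡 n (Finset.ne_of_mem_erase hn)) le_rfl
  choose R hRm hRX using hR
  refine ⟨G, hG, fun t ω => β m * j t m ω, R, fun t => (hU t).mono (h𝓛 m) le_rfl,
    fun t => (hRm t).mono h𝓡le le_rfl, ?_, fun t => ?_, fun t => ?_⟩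
  · rw [IndepFun_iff_Indep]
    exact indep_of_indep_of_le_left (indep_of_indep_of_le_right hindep
      (@measurable_pi_lambda Ω ℝ≥0 (fun _ => ℝ) 𝓡 _ _ hRm).comap_le)
      (@measurable_pi_lambda Ω ℝ≥0 (fun _ => ℝ) (𝓛 m) _ _ hU).comap_le
  · filter_upwards [hRX t] with ω hω
    rw [← hω]
    ring
  · have h := (hJ t m).inner_ae_eq (hL m) hG hS
    filter_upwards [h, hjJ t m] with ω h1 h2
    rw [← h2, h1, hem, one_mul]

/-- A coordinate of the stochastic convolution is large with a probability that depends only on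
the driving process and on a lower bound for the coefficient. -/
theorem IsStochasticConvolution.measure_oscillating_le [CompleteSpace H]
    {mΩ : MeasurableSpace Ω} {P : Measure Ω} [IsProbabilityMeasure P] {S : C0Semigroup H}
    {e : HilbertBasis ℕ ℝ H} {β : ℕ → ℝ} {L : ℕ → ℝ≥0 → Ω → ℝ} {X : ℝ≥0 → Ω → H}
    (hX : IsStochasticConvolution P S e β L X) (hL : ∀ n, IsCadlagLevyProcess (L n) P)
    (hind : iIndepFun (fun n ω t => L n t ω) P) {m : ℕ}
    (he : e m ∈ S.generator.adjoint.domain) {T : Set ℝ≥0} (hT : T.Countable) {a : ℝ≥0}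
    (hTa : T ⊆ Set.Iic a) {δ ε : ℝ} (hδ : 0 < δ) (hε : 0 < ε) :
    ∃ V : T → Ω → ℝ, (∀ t, Measurable (V t)) ∧
      (∀ t : T, (fun ω => inner ℝ (e m) (X t ω)) =ᵐ[P] V t) ∧
      (ε ≤ β m → P ((fun ω t => L m t ω) ⁻¹' oscillating T δ) ≤
        2 * P {ω | ∃ t, ε * δ / 8 < |V t ω|}) := by
  have := hT.to_subtype
  obtain ⟨G, hG, U, R, hU, hR, hUR, hXUR, hUL⟩ :=
    hX.exists_independent_decomposition hL hind he
  refine ⟨fun t ω => U t ω + R t ω, fun t => (hU t).add (hR t), fun t => hXUR t, fun hβ => ?_⟩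
  have hrestr : Measurable fun (w : ℝ≥0 → ℝ) (t : T) => w t :=
    measurable_pi_lambda _ fun t => measurable_pi_apply _
  refine le_trans ?_ (measure_prod_exists_lt_abs_sub_le (U := fun (t : T) => U t)
    (R := fun (t : T) => R t) (fun t => hU t) (fun t => hR t) (hUR.comp hrestr hrestr) _)
  refine measure_le_measure_prod
    ((measurable_pi_lambda _ (hL m).measurable) (measurableSet_oscillating hT δ)) ?_ ?_
  · simp only [Set.ofPred_exists]
    exact MeasurableSet.iUnion fun t => measurableSet_lt (f := fun _ => 2 * (ε * δ / 8))
      measurable_const (_root_.continuous_abs.measurable.comp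
        (((hU t).comp measurable_fst).sub ((hU t).comp measurable_snd)))
  · have hrep : ∀ᵐ ω ∂P, ∀ t : T,
        U t ω = β m * (L m t ω + pathConv G (fun s => L m s ω) t) :=
      ae_all_iff.2 fun t => hUL t
    filter_upwards [hrep, (hL m).cadlag] with ω hω hc hosc
    obtain ⟨s, hs⟩ := exists_forall_continuousAt_of_mem_oscillating hTa
      (w := fun t => L m t ω) hosc
    filter_upwards [hrep, (hL m).cadlag, (hL m).ae_continuousAt s] with ω' hω' hc' hs'
    -- This path is chosen so that `U ω - U ω'` is `β m` times its difference from `L m ω`. It is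
    -- continuous at `s` because `s` is fixed before `ω'` is drawn. The choice `δ / 2` gives a gap
    -- above `δ / 4`, whence the constant `ε * δ / 8`.
    obtain ⟨q, hq, hlt⟩ := hs (fun t => L m t ω' + pathConv G (fun s => L m s ω') t -
      pathConv G (fun s => L m s ω) t)
      ((hs'.add (continuous_pathConv hG hc').continuousAt).sub
        (continuous_pathConv hG hc).continuousAt) (δ / 2) (half_lt_self hδ)
    refine ⟨⟨q, hq⟩, ?_⟩
    have h1 : U q ω = _ := hω ⟨q, hq⟩
    have h2 : U q ω' = _ := hω' ⟨q, hq⟩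
    change _ < |U q ω - U q ω'|
    rw [h1, h2, ← mul_sub, abs_mul, abs_of_pos (hε.trans_le hβ)]
    calc 2 * (ε * δ / 8) = ε * (δ / 2 / 2) := by ring
      _ < ε * |L m q ω - (L m q ω' + pathConv G (fun s => L m s ω') q -
          pathConv G (fun s => L m s ω) q)| := by gcongr
      _ ≤ β m * |L m q ω - (L m q ω' + pathConv G (fun s => L m s ω') q -
          pathConv G (fun s => L m s ω) q)| := by gcongr
      _ = _ := by congr 2; ring

end Coordinates

end OUProcess

theorem corollary2p2
    {H : Type*} [NormedAddCommGroup H] [InnerProductSpace ℝ H] [CompleteSpace H]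
    {Ω : Type*} {mΩ : MeasurableSpace Ω} (P : Measure Ω) [IsProbabilityMeasure P]
    (S : OUProcess.C0Semigroup H)
    (e : HilbertBasis ℕ ℝ H)
    (he : ∀ n, e n ∈ S.generator.adjoint.domain)
    (β : ℕ → ℝ) (hβ_pos : ∀ n, 0 < β n)
    (hβ : ¬ Tendsto β atTop (𝓝 0))
    (L : ℕ → ℝ≥0 → Ω → ℝ)
    (hL : ∀ n, OUProcess.IsCadlagLevyProcess (L n) P)
    (hL_indep : iIndepFun (fun n ω t => L n t ω) P)
    (hL_ident : ∀ n, IdentDistrib (fun ω t => L n t ω) (fun ω t => L 0 t ω) P P)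
    (ν : Measure ℝ) (hν : ∀ n, OUProcess.IsJumpIntensity (L n) P ν) (hν_ne : ν ≠ 0)
    (X : ℝ≥0 → Ω → H)
    (hX : OUProcess.IsStochasticConvolution P S e β L X) :
    ¬ ∃ Y : ℝ≥0 → Ω → H, OUProcess.IsCadlagModification P X Y := by
  rintro ⟨Y, hY⟩
  obtain ⟨ε, hε, hfreq⟩ : ∃ ε > 0, ∃ᶠ m in atTop, ε ≤ β m := by
    by_contra! hcon
    refine hβ (Metric.tendsto_nhds.2 fun ε hε => ?_)
    filter_upwards [hcon ε hε] with m hm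
    rw [Real.dist_eq, sub_zero, abs_of_pos (hβ_pos m)]
    exact hm
  obtain ⟨D, hDc, hD⟩ := TopologicalSpace.exists_countable_dense ℝ≥0
  obtain ⟨δ, hδ, hp⟩ := (hν 0).exists_measure_oscillating_pos (hL 0) hν_ne hD
  set T := D ∩ Set.Iio 2 with hT
  have hTc : T.Countable := hDc.mono Set.inter_subset_left
  have hTa : T ⊆ Set.Iic 2 := fun t ht => (show t < 2 from ht.2).le
  have hV := fun m => hX.measure_oscillating_le hL hL_indep (he m) hTc hTa hδ hε
  choose V hVm hVX hVp using hV
  have hlim := hY.tendsto_measure_exists_lt e.orthonormal hTc hTa hVm hVX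
    (show 0 < ε * δ / 8 by positivity)
  have hlim2 := ENNReal.Tendsto.const_mul (a := 2) hlim (Or.inr ENNReal.ofNat_ne_top)
  rw [mul_zero] at hlim2
  -- The oscillation probability of `L 0` equals that of every `L m`, so it is infinitely often
  -- below a sequence tending to `0`.
  refine hp (le_antisymm (ge_of_tendsto_of_frequently hlim2 (hfreq.mono fun m hm => ?_)) zero_le)
  rw [← (hL_ident m).measure_mem_eq (OUProcess.measurableSet_oscillating hTc δ)]
  exact hVp m hm
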